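/- Consider an urn with $w$ white and $b$ black balls that evolves as follows. At each time $1,2,3,\dots$ a ball is drawn uniformly at random (independently of the past), its colour is observed and it is put back; if it is white, one black ball is replaced by a white one, and if it is black, one white ball is replaced by a black one. The process stops as soon as all balls in the urn have the same colour. The urn is controlled by Policy A: at time $0$ and immediately after each draw (with its replacement), if the number of white balls is greater than or equal to the number of black balls, white balls are removed so that their number becomes one less than the number of black balls; otherwise nothing is done. Let $(W_n,B_n)$ be the numbers of white and black balls after $n$ draws and after the corresponding intervention of Policy A, let $H=\min\{n\ge 0: W_n=0 \text{ or } B_n=0\}$ be the absorption time, and let $T^A(w,b)$ be the expectation of $H$ when the urn initially (before the intervention at time $0$) contains $w$ white and $b$ black balls. Then $T^A(k,k)$ is finite for every integer $k\ge 1$, and, as $k\to\infty$, $$T^A(k,k)-\left(\left(\frac{k}{2}+\frac{\pi}{16}-\frac{\sqrt{\pi k}}{4}\right)\left(\ln k+\ln 4+\gamma\right)+\frac{3\pi}{16}-\frac{\sqrt{\pi k}}{4}-\frac14\right)\to 0,$$ where $\gamma=0.5772\dots$ is the Euler–Mascheroni constant. -/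

import Mathlib

open MeasureTheory ProbabilityTheory Filter Topology
open scoped ENNReal

namespace Mabinogion

/-- The contents of the urn: `(w, b)` stands for `w` white and `b` black balls. -/
abbrev State : Type := ℕ × ℕ

/-- All remaining balls are of the same colour. -/
def Absorbed (s : State) : Prop := s.1 = 0 ∨ s.2 = 0

instance (s : State) : Decidable (Absorbed s) := by
  unfold Absorbed; infer_instance

/-- The intervention of Policy A: if there are at least as many white balls as black ones,
reduce the number of white balls to one less than the number of black balls; otherwise do
nothing. (With no black balls at all, every white ball is removed; this case never occurs when
there is a black ball initially.) -/
def policyA (s : State) : State := if s.2 ≤ s.1 then (s.2 - 1, s.2) else s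

/-- One transition of the controlled urn: nothing happens once the urn is absorbed; otherwise a
uniformly random ball is drawn, a ball of the other colour is replaced by one of the colour
drawn, and then Policy A is applied. -/
noncomputable def stepMeasure (s : State) : Measure State :=
  if Absorbed s then Measure.dirac s
  else ((s.1 : ℝ≥0∞) / (s.1 + s.2)) • Measure.dirac (policyA (s.1 + 1, s.2 - 1)) +
    ((s.2 : ℝ≥0∞) / (s.1 + s.2)) • Measure.dirac (policyA (s.1 - 1, s.2 + 1))

instance (s : State) : IsProbabilityMeasure (stepMeasure s) := by
  unfold stepMeasure
  split_ifs with h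
  · infer_instance
  · constructor
    have h0 : (s.1 : ℝ≥0∞) + s.2 ≠ 0 := by
      unfold Absorbed at h
      push Not at h
      simp [h.1]
    have ht : (s.1 : ℝ≥0∞) + s.2 ≠ ∞ := by simp
    simp only [Measure.coe_add, Measure.coe_smul, Pi.add_apply, Pi.smul_apply, measure_univ,
      smul_eq_mul, mul_one]
    rw [← ENNReal.add_div, ENNReal.div_self h0 ht]

/-- The transition kernel of the controlled urn. -/
noncomputable def stepKernel : Kernel State State where
  toFun := stepMeasure
  measurable' := measurable_of_countable _

instance : IsMarkovKernel stepKernel := ⟨fun s => inferInstanceAs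
  (IsProbabilityMeasure (stepMeasure s))⟩

/-- The law of the next state given the history up to time `n`: it depends only on the state at
time `n`. -/
noncomputable def historyKernel (n : ℕ) : Kernel ((_ : Finset.Iic n) → State) State :=
  stepKernel.comap (fun h => h ⟨n, Finset.mem_Iic.2 le_rfl⟩) (measurable_pi_apply _)

instance (n : ℕ) : IsMarkovKernel (historyKernel n) := by
  unfold historyKernel; infer_instance

/-- The law, on the space of trajectories, of the urn process controlled by Policy A and started
from `w` white and `b` black balls. Policy A is applied at time `0` too, so the time-`0` state of
the trajectory is `policyA (w, b)`. -/
noncomputable def lawA (w b : ℕ) : Measure (ℕ → State) :=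
  Kernel.traj (X := fun _ => State) historyKernel 0 (fun _ => policyA (w, b))

/-- The absorption time `H = min {n | Wₙ = 0 or Bₙ = 0}` of a trajectory (`⊤` if it is never
absorbed). -/
noncomputable def absorptionTime (x : ℕ → State) : ℕ∞ :=
  ⨅ (n : ℕ) (_ : Absorbed (x n)), (n : ℕ∞)

/-- The expected absorption time under Policy A, as an extended nonnegative real. -/
noncomputable def TA (w b : ℕ) : ℝ≥0∞ :=
  ∫⁻ x, (absorptionTime x : ℝ≥0∞) ∂(lawA w b)

end Mabinogion

/-!
Between two interventions of Policy A the number of balls is a constant `2 * k + 1`, and the urn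
moves until it has no white balls or `k + 1` of them. The increments of the expected duration,
divided by binomial coefficients, satisfy a recursion that can be summed, so first-step analysis
gives the expected time `t k` from `(k, k)` in the form
`t (k + 1) = t k + 2 / (1 + a k) * ((k + 1 / 2) * O k - t k)`, where `a k = 4 ^ k / (2k choose k)`
and `O k = 1 + 1 / 3 + ⋯ + 1 / (2 * k - 1)`. Thus `t (k + 1)` is a weighted average of `t k` and
`(k + 1 / 2) * O k`. The claimed expansion with `√(π k)` replaced by `a k` and
`log k + log 4 + γ` by `2 * O k` satisfies the same recursion up to an error that is `o(1)` relative
to the weight `2 / (1 + a k)`. These weights have a divergent sum, so the averaging forgets the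
initial value and the two sequences have the same asymptotics. Wallis' product and the
approximation of `O k` by a logarithm with an error of order `1 / k ^ 2` undo the
replacement.
-/

namespace Mabinogion

open scoped Real
open Real.Wallis (W)

/-! ### Entrance times of Markov chains -/

section MarkovChain

variable {S : Type*}

/-- The first time at which the trajectory `x` is in `A`, and `⊤` if it never is. -/
noncomputable def entranceTime (A : Set S) (x : ℕ → S) : ℕ∞ :=
  ⨅ (n : ℕ) (_ : x n ∈ A), (n : ℕ∞)

lemma entranceTime_eq_tsum {A : Set S} {x : ℕ → S} (h : ∀ n, x n ∈ A → x (n + 1) ∈ A) :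
    (entranceTime A x : ℝ≥0∞) = ∑' n, Aᶜ.indicator 1 (x n) := by
  classical
  by_cases hex : ∃ n, x n ∈ A
  · set N := Nat.find hex
    have hN : entranceTime A x = N :=
      le_antisymm (iInf₂_le N (Nat.find_spec hex))
        (le_iInf₂ fun n hn => by exact_mod_cast Nat.find_min' hex hn)
    have hbefore : ∀ n ∈ Finset.range N, Aᶜ.indicator (1 : S → ℝ≥0∞) (x n) = 1 := fun n hn =>
      Set.indicator_of_mem (Nat.find_min hex (Finset.mem_range.1 hn)) _
    have hafter : ∀ n, N ≤ n → x n ∈ A := fun n hn => by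
      induction n, hn using Nat.le_induction with
      | base => exact Nat.find_spec hex
      | succ m _ ih => exact h m ih
    rw [hN, tsum_eq_sum (s := Finset.range N) fun n hn => Set.indicator_of_notMem
      (Set.notMem_compl_iff.2 (hafter n (by simpa using hn))) _, Finset.sum_congr rfl hbefore]
    simp
  · push Not at hex
    have htop : entranceTime A x = ⊤ := by simp [entranceTime, hex]
    rw [htop, tsum_congr fun n => Set.indicator_of_mem (hex n) _]
    exact (ENNReal.tsum_const_eq_top_of_ne_zero one_ne_zero).symm

variable [MeasurableSpace S]

lemma measurable_indicator_eval {A : Set S} (hA : MeasurableSet A) (n : ℕ) :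
    Measurable fun x : ℕ → S => A.indicator (1 : S → ℝ≥0∞) (x n) :=
  (measurable_one.indicator hA).comp (measurable_pi_apply n)

lemma map_prodMap_compProd_comap {T U : Type*} [MeasurableSpace T] [MeasurableSpace U]
    (μ : Measure T) [SFinite μ] (κ : Kernel S U) [IsSFiniteKernel κ] {g : T → S}
    (hg : Measurable g) : (μ ⊗ₘ κ.comap g hg).map (Prod.map g id) = μ.map g ⊗ₘ κ := by
  refine Measure.ext_of_lintegral _ fun f hf => ?_
  rw [lintegral_map hf (by fun_prop), Measure.lintegral_compProd (by fun_prop),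
    Measure.lintegral_compProd hf, lintegral_map hf.lintegral_kernel_prod_right' hg]
  rfl

variable (κ : Kernel S S) [IsMarkovKernel κ] (s : S)

/-- The law, on the space of trajectories, of the homogeneous Markov chain with transition kernel
`κ` started at `s`. -/
noncomputable def chainLaw : Measure (ℕ → S) :=
  Kernel.traj (X := fun _ => S)
    (fun n => κ.comap (fun h : Finset.Iic n → S => h ⟨n, Finset.mem_Iic.2 le_rfl⟩)
      (measurable_pi_apply _)) 0 (fun _ => s)

instance : IsProbabilityMeasure (chainLaw κ s) := by
  unfold chainLaw; infer_instance

lemma chainLaw_map_zero : (chainLaw κ s).map (fun x => x 0) = Measure.dirac s := by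
  refine Measure.ext_of_lintegral _ fun f hf => ?_
  rw [lintegral_map hf (by fun_prop), lintegral_dirac' _ hf, chainLaw,
    Kernel.lintegral_traj _ (by fun_prop)]
  simp [Function.updateFinset]

lemma chainLaw_map_pair (n : ℕ) : (chainLaw κ s).map (fun x => (x n, x (n + 1))) =
    (chainLaw κ s).map (fun x => x n) ⊗ₘ κ := by
  have hhistory := Kernel.partialTraj_compProd_eq_map_traj (X := fun _ => S)
    (κ := fun n => κ.comap (fun h : Finset.Iic n → S => h ⟨n, Finset.mem_Iic.2 le_rfl⟩)
      (measurable_pi_apply _)) (Nat.zero_le n) (x₀ := fun _ => s)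
  have hlast := congrArg (Measure.map (Prod.map
    (fun h : Finset.Iic n → S => h ⟨n, Finset.mem_Iic.2 le_rfl⟩) id)) hhistory
  rw [← Kernel.traj_map_frestrictLe_apply, map_prodMap_compProd_comap,
    Measure.map_map (by fun_prop) (by fun_prop),
    Measure.map_map (by fun_prop) (by fun_prop)] at hlast
  exact hlast.symm

variable {κ s}

lemma lintegral_chainLaw_succ {f : S → ℝ≥0∞} (hf : Measurable f) (n : ℕ) :
    ∫⁻ x, f (x (n + 1)) ∂chainLaw κ s = ∫⁻ x, ∫⁻ y, f y ∂κ (x n) ∂chainLaw κ s := by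
  rw [← lintegral_map (f := fun p : S × S => f p.2) (by fun_prop)
      (by fun_prop : Measurable fun x : ℕ → S => (x n, x (n + 1))),
    chainLaw_map_pair, Measure.lintegral_compProd (by fun_prop),
    lintegral_map hf.lintegral_kernel (by fun_prop)]

lemma ae_chainLaw_succ {p : S × S → Prop} (hp : MeasurableSet {z | p z}) {n : ℕ}
    (h : ∀ᵐ x ∂chainLaw κ s, ∀ᵐ y ∂κ (x n), p (x n, y)) :
    ∀ᵐ x ∂chainLaw κ s, p (x n, x (n + 1)) := by
  refine ae_of_ae_map (f := fun x : ℕ → S => (x n, x (n + 1))) (by fun_prop) ?_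
  rw [chainLaw_map_pair]
  refine Measure.ae_compProd_of_ae_ae hp ?_
  have hmeas : MeasurableSet {a | ∀ᵐ y ∂κ a, p (a, y)} :=
    Kernel.measurable_kernel_prodMk_left hp.compl (measurableSet_singleton 0)
  exact (ae_map_iff (measurable_pi_apply n).aemeasurable hmeas).2 h

lemma ae_chainLaw_mem {R : Set S} (hR : MeasurableSet R) (hinv : ∀ s ∈ R, ∀ᵐ y ∂κ s, y ∈ R)
    (hs : s ∈ R) (n : ℕ) : ∀ᵐ x ∂chainLaw κ s, x n ∈ R := by
  induction n with
  | zero =>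
    refine ae_of_ae_map (f := fun x : ℕ → S => x 0) (p := (· ∈ R))
      (measurable_pi_apply 0).aemeasurable ?_
    rw [chainLaw_map_zero]
    exact (ae_dirac_iff hR).2 hs
  | succ n ih =>
    refine ae_chainLaw_succ (p := fun z => z.2 ∈ R) (measurable_snd hR) ?_
    filter_upwards [ih] with x hx using hinv _ hx

lemma lintegral_entranceTime_eq_tsum {A : Set S} (hA : MeasurableSet A)
    (habs : ∀ s ∈ A, ∀ᵐ y ∂κ s, y ∈ A) :
    ∫⁻ x, (entranceTime A x : ℝ≥0∞) ∂chainLaw κ s =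
      ∑' n, ∫⁻ x, Aᶜ.indicator 1 (x n) ∂chainLaw κ s := by
  have hstays : ∀ᵐ x ∂chainLaw κ s, ∀ n, x n ∈ A → x (n + 1) ∈ A := by
    refine ae_all_iff.2 fun n => ae_chainLaw_succ (p := fun z => z.1 ∈ A → z.2 ∈ A)
      ((measurable_fst hA).imp (measurable_snd hA)) (ae_of_all _ fun x => ?_)
    exact eventually_imp_distrib_left.2 (habs (x n))
  rw [← lintegral_tsum fun n => (measurable_indicator_eval hA.compl n).aemeasurable]
  exact lintegral_congr_ae (hstays.mono fun x hx => entranceTime_eq_tsum hx)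

/-- The domination `v n ≤ M * a n` forces the remainder `v n` of the telescoped series to `0`. -/
lemma tsum_eq_of_eq_add_succ {a v : ℕ → ℝ≥0∞} {M : ℝ≥0∞} (hM : M ≠ ∞) (hv : v 0 ≠ ∞)
    (hstep : ∀ n, v n = a n + v (n + 1)) (hle : ∀ n, v n ≤ M * a n) : ∑' n, a n = v 0 := by
  have hpartial : ∀ n, ∑ i ∈ Finset.range n, a i + v n = v 0 := fun n => by
    induction n with
    | zero => simp
    | succ n ih => rw [Finset.sum_range_succ, add_assoc, ← hstep, ih]
  have hsum_le : ∑' n, a n ≤ v 0 := by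
    rw [ENNReal.tsum_eq_iSup_nat]
    exact iSup_le fun n => le_self_add.trans_eq (hpartial n)
  have ha : Tendsto a atTop (𝓝 0) :=
    ENNReal.tendsto_atTop_zero_of_tsum_ne_top (ne_top_of_le_ne_top hv hsum_le)
  have hMa : Tendsto (fun n => M * a n) atTop (𝓝 0) := by
    simpa using ENNReal.Tendsto.const_mul ha (Or.inr hM)
  have hremainder : Tendsto v atTop (𝓝 0) :=
    tendsto_of_tendsto_of_tendsto_of_le_of_le tendsto_const_nhds hMa (fun _ => zero_le) hle
  have hlim := (ENNReal.tendsto_nat_tsum a).add hremainder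
  simp only [hpartial, add_zero] at hlim
  exact tendsto_nhds_unique hlim tendsto_const_nhds

theorem lintegral_entranceTime_eq_of_first_step {A R : Set S} (hA : MeasurableSet A)
    (hR : MeasurableSet R) (habs : ∀ s ∈ A, ∀ᵐ y ∂κ s, y ∈ A)
    (hinv : ∀ s ∈ R, ∀ᵐ y ∂κ s, y ∈ R) {V : S → ℝ≥0∞} (hV : Measurable V) {M : ℝ≥0∞} (hM : M ≠ ∞)
    (hfirst : ∀ s ∈ R, V s = Aᶜ.indicator 1 s + ∫⁻ y, V y ∂κ s)
    (hzero : ∀ s ∈ R ∩ A, V s = 0) (hbound : ∀ s ∈ R, V s ≤ M) (hs : s ∈ R) :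
    ∫⁻ x, (entranceTime A x : ℝ≥0∞) ∂chainLaw κ s = V s := by
  have hmem := ae_chainLaw_mem hR hinv hs
  have hind := measurable_indicator_eval hA.compl
  have hdom : ∀ s ∈ R, V s ≤ M * Aᶜ.indicator 1 s := fun s hs => by
    by_cases hsA : s ∈ A
    · simp [hzero s ⟨hs, hsA⟩]
    · simpa [hsA] using hbound s hs
  have hstart : ∫⁻ x, V (x 0) ∂chainLaw κ s = V s := by
    rw [← lintegral_map hV (measurable_pi_apply 0), chainLaw_map_zero, lintegral_dirac' _ hV]
  rw [lintegral_entranceTime_eq_tsum hA habs, ← hstart]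
  refine tsum_eq_of_eq_add_succ (v := fun n => ∫⁻ x, V (x n) ∂chainLaw κ s) hM
    (by rw [hstart]; exact ne_top_of_le_ne_top hM (hbound s hs)) (fun n => ?_) fun n => ?_
  · rw [lintegral_chainLaw_succ hV, ← lintegral_add_left (hind n)]
    exact lintegral_congr_ae ((hmem n).mono fun x hx => hfirst _ hx)
  · rw [← lintegral_const_mul _ (hind n)]
    exact lintegral_mono_ae ((hmem n).mono fun x hx => hdom _ hx)

end MarkovChain

/-! ### Partial row sums of Pascal's triangle -/

/-- The sum of the first `j` entries of row `M` of Pascal's triangle. -/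
noncomputable def chooseSum (M j : ℕ) : ℝ := ∑ i ∈ Finset.range j, (M.choose i : ℝ)

/-- The entry `1 / (M * (M - 1).choose j)` of Leibniz' harmonic triangle, written without
subtraction. -/
noncomputable def leibnizWeight (M j : ℕ) : ℝ := 1 / ((j + 1) * M.choose (j + 1))

/-- The sum of the reciprocals of the first `n` odd numbers. -/
noncomputable def oddHarmonic (n : ℕ) : ℝ := ∑ i ∈ Finset.range n, 1 / (2 * (i : ℝ) + 1)

/-- The reciprocal of the probability that a simple random walk is back at `0` after `2 * n`
steps. -/
noncomputable def invReturn (n : ℕ) : ℝ := 4 ^ n / n.centralBinom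

lemma chooseSum_succ (M j : ℕ) : chooseSum M (j + 1) = chooseSum M j + M.choose j :=
  Finset.sum_range_succ _ _

lemma chooseSum_succ_succ (M j : ℕ) :
    chooseSum (M + 1) (j + 1) = chooseSum M (j + 1) + chooseSum M j := by
  induction j with
  | zero => simp [chooseSum]
  | succ j ih =>
    rw [chooseSum_succ, ih, chooseSum_succ M (j + 1), chooseSum_succ M j, Nat.choose_succ_succ]
    push_cast
    ring

lemma chooseSum_succ_pos (M j : ℕ) : 0 < chooseSum M (j + 1) :=
  Finset.sum_pos' (fun _ _ => by positivity) ⟨0, by simp⟩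

lemma two_mul_chooseSum_half (n : ℕ) :
    2 * chooseSum (2 * n) (n + 1) = 4 ^ n + n.centralBinom := by
  have hodd : chooseSum (2 * n + 1) (n + 1) = 4 ^ n := by
    unfold chooseSum
    exact_mod_cast Nat.sum_range_choose_halfway n
  rw [chooseSum_succ_succ] at hodd
  rw [Nat.centralBinom_eq_two_mul_choose, ← hodd, chooseSum_succ]
  ring

lemma leibnizWeight_nonneg (M j : ℕ) : 0 ≤ leibnizWeight M j := by
  unfold leibnizWeight; positivity

lemma leibnizWeight_eq_add {M j : ℕ} (h : j < M) :
    leibnizWeight M j = leibnizWeight (M + 1) j + leibnizWeight (M + 1) (j + 1) := by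
  have hpos : (0 : ℝ) < M.choose (j + 1) := by exact_mod_cast Nat.choose_pos h
  have hpos' : (0 : ℝ) < M.choose j := by exact_mod_cast Nat.choose_pos h.le
  have hsucc : ((M : ℝ) + 1) * M.choose j = (M + 1).choose (j + 1) * (j + 1) := by
    exact_mod_cast Nat.add_one_mul_choose_eq M j
  have hsucc' : ((M : ℝ) + 1) * M.choose (j + 1) = (M + 1).choose (j + 2) * (j + 2) := by
    exact_mod_cast Nat.add_one_mul_choose_eq M (j + 1)
  have hpascal : ((M + 1).choose (j + 1) : ℝ) = M.choose j + M.choose (j + 1) := by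
    exact_mod_cast Nat.choose_succ_succ M j
  have hleft : leibnizWeight (M + 1) j = 1 / ((M + 1) * M.choose j) := by
    rw [leibnizWeight, hsucc, mul_comm]
  have hright : leibnizWeight (M + 1) (j + 1) = 1 / ((M + 1) * M.choose (j + 1)) := by
    rw [leibnizWeight, hsucc']
    push_cast
    ring
  rw [hleft, hright, leibnizWeight]
  field_simp
  rw [hsucc, hpascal]
  ring

lemma leibnizWeight_central (n : ℕ) :
    leibnizWeight (2 * n + 2) n = 1 / (2 * (2 * n + 1) * n.centralBinom) := by
  have h : ((n : ℝ) + 1) * (n + 1).centralBinom = 2 * (2 * n + 1) * n.centralBinom := by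
    exact_mod_cast n.succ_mul_centralBinom_succ
  rw [← h, Nat.centralBinom_eq_two_mul_choose (n + 1), leibnizWeight, mul_add_one]

lemma leibnizWeight_central_eq_two_mul (n : ℕ) :
    leibnizWeight (2 * n + 1) n = 2 * leibnizWeight (2 * n + 2) n := by
  have h : ((2 * n + 2).choose (n + 1) : ℝ) = 2 * (2 * n + 1).choose (n + 1) := by
    rw [Nat.choose_succ_succ, ← Nat.choose_symm_half n]
    push_cast
    ring
  rw [leibnizWeight, leibnizWeight, h]
  field_simp

/-- Pascal's rule and its analogue `leibnizWeight_eq_add` telescope against each other, so that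
passing from row `M` to row `M + 1` only leaves a boundary term. -/
lemma sum_chooseSum_mul_leibnizWeight {M m : ℕ} (h : m ≤ M) :
    ∑ j ∈ Finset.range m, chooseSum M (j + 1) * leibnizWeight M j =
      ∑ j ∈ Finset.range m, chooseSum (M + 1) (j + 1) * leibnizWeight (M + 1) j +
        chooseSum M m * leibnizWeight (M + 1) m := by
  induction m with
  | zero => simp [chooseSum]
  | succ m ih =>
    rw [Finset.sum_range_succ, Finset.sum_range_succ, ih (by omega),
      leibnizWeight_eq_add (show m < M by omega), chooseSum_succ_succ]
    ring

lemma oddHarmonic_succ (n : ℕ) : oddHarmonic (n + 1) = oddHarmonic n + 1 / (2 * n + 1) :=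
  Finset.sum_range_succ _ _

theorem sum_chooseSum_mul_leibnizWeight_half (n : ℕ) :
    ∑ j ∈ Finset.range n, chooseSum (2 * n) (j + 1) * leibnizWeight (2 * n) j =
      oddHarmonic n / 2 := by
  induction n with
  | zero => simp [oddHarmonic]
  | succ n ih =>
    have hC : (0 : ℝ) < n.centralBinom := by exact_mod_cast n.centralBinom_pos
    have hrow := sum_chooseSum_mul_leibnizWeight (show n ≤ 2 * n by omega)
    have hrow' := sum_chooseSum_mul_leibnizWeight (show n ≤ 2 * n + 1 by omega)
    have hincrement : n.centralBinom * leibnizWeight (2 * n + 2) n = 1 / (2 * n + 1) / 2 := by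
      rw [leibnizWeight_central]
      field_simp
    rw [ih, leibnizWeight_central_eq_two_mul] at hrow
    rw [mul_add_one, Finset.sum_range_succ, oddHarmonic_succ, chooseSum_succ_succ (2 * n + 1),
      chooseSum_succ_succ (2 * n), chooseSum_succ (2 * n), ← Nat.centralBinom_eq_two_mul_choose]
    linear_combination hincrement - hrow - hrow'

lemma sum_mul_sum_sub_sum {R : Type*} [CommRing R] (c w : ℕ → R) (m : ℕ) :
    ∑ i ∈ Finset.range (m + 1),
        c i * (∑ j ∈ Finset.range m, w j - ∑ j ∈ Finset.range i, w j) =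
      ∑ j ∈ Finset.range m, (∑ i ∈ Finset.range (j + 1), c i) * w j := by
  induction m with
  | zero => simp
  | succ m ih =>
    rw [Finset.sum_range_succ (fun j => (∑ i ∈ Finset.range (j + 1), c i) * w j) m, ← ih,
      Finset.sum_range_succ _ (m + 1), sub_self, mul_zero, add_zero, Finset.sum_mul,
      ← Finset.sum_add_distrib]
    refine Finset.sum_congr rfl fun i _ => ?_
    rw [Finset.sum_range_succ w m]
    ring

/-! ### The urn with a fixed number of balls -/

/-- The increments of a solution of the first-step equation for `M + 1` balls, divided by the
increments `M.choose i` of the harmonic function, drop by this amount between `0` and `i`. -/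
noncomputable def slopeDrop (M i : ℕ) : ℝ := (M + 1) * ∑ j ∈ Finset.range i, leibnizWeight M j

/-- The first increment of the solution of the first-step equation for `M + 1` balls that is `0` at
`0` and `t` at `m + 1` white balls. -/
noncomputable def initialSlope (M m : ℕ) (t : ℝ) : ℝ :=
  (t + ∑ i ∈ Finset.range (m + 1), M.choose i * slopeDrop M i) / chooseSum M (m + 1)

/-- The expected time until the uncontrolled urn of `M + 1` balls, `w` of them white, has `0` or
`m + 1` white balls, where an extra time `t` is added in the latter case. -/
noncomputable def levelValue (M m : ℕ) (t : ℝ) (w : ℕ) : ℝ :=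
  ∑ i ∈ Finset.range w, M.choose i * (initialSlope M m t - slopeDrop M i)

section Level

variable (M m : ℕ) (t : ℝ)

lemma slopeDrop_succ (i : ℕ) :
    slopeDrop M (i + 1) = slopeDrop M i + (M + 1) * leibnizWeight M i := by
  rw [slopeDrop, Finset.sum_range_succ, mul_add, ← slopeDrop]

lemma slopeDrop_mono : Monotone (slopeDrop M) :=
  monotone_nat_of_le_succ fun i => by
    rw [slopeDrop_succ]
    exact le_add_of_nonneg_right (mul_nonneg (by positivity) (leibnizWeight_nonneg M i))

lemma levelValue_zero : levelValue M m t 0 = 0 := rfl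

lemma levelValue_succ (w : ℕ) : levelValue M m t (w + 1) =
    levelValue M m t w + M.choose w * (initialSlope M m t - slopeDrop M w) :=
  Finset.sum_range_succ _ _

lemma chooseSum_mul_initialSlope : chooseSum M (m + 1) * initialSlope M m t =
    t + ∑ i ∈ Finset.range (m + 1), M.choose i * slopeDrop M i :=
  mul_div_cancel₀ _ (chooseSum_succ_pos M m).ne'

lemma levelValue_top : levelValue M m t (m + 1) = t := by
  simp only [levelValue, mul_sub, Finset.sum_sub_distrib]
  rw [← Finset.sum_mul, ← chooseSum, chooseSum_mul_initialSlope, add_sub_cancel_right]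

variable {M m t}

/-- The increments of `levelValue` change sign at most once, from positive to negative, so its
minimum is attained at one of the two ends. -/
lemma levelValue_nonneg (ht : 0 ≤ t) {w : ℕ} (hw : w ≤ m + 1) : 0 ≤ levelValue M m t w := by
  rcases le_total (slopeDrop M w) (initialSlope M m t) with hup | hdown
  · exact Finset.sum_nonneg fun i hi => mul_nonneg (by positivity)
      (sub_nonneg.2 ((slopeDrop_mono M (Finset.mem_range.1 hi).le).trans hup))
  · have htop := levelValue_top M m t
    rw [levelValue, ← Finset.sum_range_add_sum_Ico _ hw, ← levelValue] at htop
    have htail : ∑ i ∈ Finset.Ico w (m + 1),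
        (M.choose i : ℝ) * (initialSlope M m t - slopeDrop M i) ≤ 0 :=
      Finset.sum_nonpos fun i hi => mul_nonpos_of_nonneg_of_nonpos (by positivity)
        (sub_nonpos.2 (hdown.trans (slopeDrop_mono M (Finset.mem_Ico.1 hi).1)))
    linarith

lemma levelValue_first_step {w b : ℕ} (hM : w + b = M) (hb : b ≠ 0) :
    (M + 1) * levelValue M m t (w + 1) =
      (M + 1) + (w + 1) * levelValue M m t (w + 2) + b * levelValue M m t w := by
  have hpos : (0 : ℝ) < M.choose (w + 1) := by exact_mod_cast Nat.choose_pos (by omega)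
  have hMR : (M : ℝ) = w + b := by exact_mod_cast hM.symm
  have hchoose : ((w : ℝ) + 1) * M.choose (w + 1) = b * M.choose w := by
    have h := Nat.choose_succ_right_eq M w
    rw [show M - w = b by omega, mul_comm, mul_comm _ b] at h
    exact_mod_cast h
  have hweight : ((w : ℝ) + 1) * M.choose (w + 1) * leibnizWeight M w = 1 :=
    mul_one_div_cancel (by positivity)
  rw [levelValue_succ M m t (w + 1), levelValue_succ M m t w, slopeDrop_succ, hMR]
  linear_combination (w + b + 1 : ℝ) * hweight -
    (initialSlope M m t - slopeDrop M w) * hchoose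

variable (M m t)

lemma levelValue_self : levelValue M m t m = t + M.choose m / chooseSum M (m + 1) *
    ((M + 1) * ∑ j ∈ Finset.range m, chooseSum M (j + 1) * leibnizWeight M j - t) := by
  have hS := (chooseSum_succ_pos M m).ne'
  have habel : (M + 1) * ∑ j ∈ Finset.range m, chooseSum M (j + 1) * leibnizWeight M j =
      chooseSum M (m + 1) * slopeDrop M m -
        ∑ i ∈ Finset.range (m + 1), M.choose i * slopeDrop M i := by
    simp only [chooseSum]
    rw [← sum_mul_sum_sub_sum, Finset.mul_sum, Finset.sum_mul, ← Finset.sum_sub_distrib]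
    refine Finset.sum_congr rfl fun i _ => ?_
    rw [slopeDrop, slopeDrop]
    ring
  have hslope : chooseSum M (m + 1) * (initialSlope M m t - slopeDrop M m) =
      t - (M + 1) * ∑ j ∈ Finset.range m, chooseSum M (j + 1) * leibnizWeight M j := by
    rw [habel, mul_sub, chooseSum_mul_initialSlope]
    ring
  have htop := levelValue_succ M m t m
  rw [levelValue_top] at htop
  rw [← neg_sub t, ← hslope]
  field_simp
  linarith

end Level

lemma levelValue_half (n : ℕ) (t : ℝ) : levelValue (2 * n) n t n =
    t + 2 / (1 + invReturn n) * ((n + 1 / 2) * oddHarmonic n - t) := by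
  have hC : (0 : ℝ) < n.centralBinom := by exact_mod_cast n.centralBinom_pos
  have hS := chooseSum_succ_pos (2 * n) n
  have hratio : ((2 * n).choose n : ℝ) / chooseSum (2 * n) (n + 1) = 2 / (1 + invReturn n) := by
    have h := two_mul_chooseSum_half n
    rw [← Nat.centralBinom_eq_two_mul_choose, invReturn]
    field_simp
    linarith
  rw [levelValue_self, sum_chooseSum_mul_leibnizWeight_half, hratio]
  push_cast
  ring

/-! ### The controlled urn -/

/-- The expected absorption time of the controlled urn started with `k` white and `k` black balls.
Policy A turns `(k + 1, k + 1)` into `(k, k + 1)`, and from there the urn evolves without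
intervention until it runs out of white balls or has `k + 1` white and `k` black ones, which
Policy A treats like `(k, k)`. -/
noncomputable def tieTime : ℕ → ℝ
  | 0 => 0
  | k + 1 => levelValue (2 * k) k (tieTime k) k

/-- The expected absorption time of the controlled urn in a state `s` with fewer white balls than
black balls and an odd total number of balls. -/
noncomputable def stateValue (s : State) : ℝ :=
  levelValue (2 * ((s.1 + s.2) / 2)) ((s.1 + s.2) / 2) (tieTime ((s.1 + s.2) / 2)) s.1

/-- The states with at most `N` balls that Policy A can reach from a tie. -/
def reachable (N : ℕ) : Set State := {s | s.1 < s.2 ∧ Odd (s.1 + s.2) ∧ s.1 + s.2 ≤ N}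

lemma tieTime_nonneg (k : ℕ) : 0 ≤ tieTime k := by
  induction k with
  | zero => exact le_rfl
  | succ k ih => exact levelValue_nonneg ih k.le_succ

lemma tieTime_succ (k : ℕ) : tieTime (k + 1) =
    tieTime k + 2 / (1 + invReturn k) * ((k + 1 / 2) * oddHarmonic k - tieTime k) :=
  levelValue_half k (tieTime k)

lemma stateValue_eq {w b n : ℕ} (h : w + b = 2 * n + 1) :
    stateValue (w, b) = levelValue (2 * n) n (tieTime n) w := by
  have hn : (w + b) / 2 = n := by omega
  simp only [stateValue, hn]

lemma stateValue_nonneg {N : ℕ} {s : State} (hs : s ∈ reachable N) : 0 ≤ stateValue s :=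
  levelValue_nonneg (tieTime_nonneg _) (by have := hs.1; omega)

lemma stateValue_policyA {w b n : ℕ} (hn : n ≠ 0) (hw : w ≤ n + 1) (h : w + b = 2 * n + 1) :
    stateValue (policyA (w, b)) = levelValue (2 * n) n (tieTime n) w := by
  rcases hw.lt_or_eq with hlt | rfl
  · rw [policyA, if_neg (by simp only; omega), stateValue_eq h]
  · obtain ⟨m, rfl⟩ := Nat.exists_eq_add_one_of_ne_zero hn
    obtain rfl : b = m + 1 := by omega
    rw [policyA, if_pos (by simp), levelValue_top]
    exact stateValue_eq (by omega : m + (m + 1) = 2 * m + 1)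

lemma stateValue_first_step {N : ℕ} {s : State} (hs : s ∈ reachable N) (habs : ¬ Absorbed s) :
    stateValue s = 1 + (s.1 * stateValue (policyA (s.1 + 1, s.2 - 1)) +
      s.2 * stateValue (policyA (s.1 - 1, s.2 + 1))) / (s.1 + s.2) := by
  obtain ⟨_ | w, b⟩ := s
  · exact absurd (Or.inl rfl) habs
  obtain ⟨hlt, ⟨n, hn⟩, -⟩ := hs
  simp only at hlt hn
  simp only [Nat.add_sub_cancel]
  rw [stateValue_eq hn, stateValue_policyA (n := n) (by omega) (by omega) (by omega),
    stateValue_policyA (n := n) (by omega) (by omega) (by omega)]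
  have hstep := levelValue_first_step (m := n) (t := tieTime n) (show w + b = 2 * n by omega)
    (by omega)
  have hcast : ((2 * n : ℕ) : ℝ) + 1 = w + 1 + b := by
    exact_mod_cast (by omega : 2 * n + 1 = w + 1 + b)
  rw [hcast] at hstep
  push_cast
  field_simp
  linear_combination hstep

lemma policyA_mem_reachable {N w b : ℕ} (h : w ≤ b + 1) (hodd : Odd (w + b)) (hN : w + b ≤ N)
    (hb : b ≠ 0) : policyA (w, b) ∈ reachable N := by
  rw [Nat.odd_iff] at hodd
  unfold policyA reachable
  split_ifs <;> simp only [Set.mem_ofPred_eq, Nat.odd_iff] at * <;> omega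

lemma policyA_white_mem_reachable {N : ℕ} {s : State} (hs : s ∈ reachable N)
    (habs : ¬ Absorbed s) : policyA (s.1 + 1, s.2 - 1) ∈ reachable N := by
  obtain ⟨hlt, hodd, hN⟩ := hs
  simp only [Absorbed, not_or, Nat.odd_iff] at habs hodd
  exact policyA_mem_reachable (by omega) (Nat.odd_iff.2 (by omega)) (by omega) (by omega)

lemma policyA_black_mem_reachable {N : ℕ} {s : State} (hs : s ∈ reachable N)
    (habs : ¬ Absorbed s) : policyA (s.1 - 1, s.2 + 1) ∈ reachable N := by
  obtain ⟨hlt, hodd, hN⟩ := hs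
  simp only [Absorbed, not_or, Nat.odd_iff] at habs hodd
  exact policyA_mem_reachable (by omega) (Nat.odd_iff.2 (by omega)) (by omega) (by omega)

lemma finite_reachable (N : ℕ) : (reachable N).Finite :=
  ((Set.finite_Iic N).prod (Set.finite_Iic N)).subset fun s hs => by
    obtain ⟨-, -, hN⟩ := hs
    exact ⟨Set.mem_Iic.2 (by omega), Set.mem_Iic.2 (by omega)⟩

lemma stepKernel_of_absorbed {s : State} (hs : Absorbed s) : stepKernel s = Measure.dirac s :=
  if_pos hs

lemma stepKernel_of_not_absorbed {s : State} (hs : ¬ Absorbed s) : stepKernel s =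
    ((s.1 : ℝ≥0∞) / (s.1 + s.2)) • Measure.dirac (policyA (s.1 + 1, s.2 - 1)) +
      ((s.2 : ℝ≥0∞) / (s.1 + s.2)) • Measure.dirac (policyA (s.1 - 1, s.2 + 1)) :=
  if_neg hs

lemma ae_stepKernel {s : State} {p : State → Prop} (habs : Absorbed s → p s)
    (hwhite : ¬ Absorbed s → p (policyA (s.1 + 1, s.2 - 1)))
    (hblack : ¬ Absorbed s → p (policyA (s.1 - 1, s.2 + 1))) : ∀ᵐ y ∂stepKernel s, p y := by
  by_cases hs : Absorbed s
  · rw [stepKernel_of_absorbed hs, ae_dirac_eq]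
    exact habs hs
  · rw [stepKernel_of_not_absorbed hs, ae_add_measure_iff]
    exact ⟨Measure.ae_smul_measure (by rw [ae_dirac_eq]; exact hwhite hs) _,
      Measure.ae_smul_measure (by rw [ae_dirac_eq]; exact hblack hs) _⟩

lemma ae_stepKernel_mem_reachable {N : ℕ} {s : State} (hs : s ∈ reachable N) :
    ∀ᵐ y ∂stepKernel s, y ∈ reachable N :=
  ae_stepKernel (fun _ => hs) (policyA_white_mem_reachable hs) (policyA_black_mem_reachable hs)

lemma lintegral_ofReal_stepKernel {s : State} (hs : ¬ Absorbed s) {g : State → ℝ}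
    (hwhite : 0 ≤ g (policyA (s.1 + 1, s.2 - 1))) (hblack : 0 ≤ g (policyA (s.1 - 1, s.2 + 1))) :
    ∫⁻ y, ENNReal.ofReal (g y) ∂stepKernel s =
      ENNReal.ofReal ((s.1 * g (policyA (s.1 + 1, s.2 - 1)) +
        s.2 * g (policyA (s.1 - 1, s.2 + 1))) / (s.1 + s.2)) := by
  have hpos : (0 : ℝ) < s.1 + s.2 := by
    simp only [Absorbed, not_or] at hs
    exact_mod_cast (by omega : 0 < s.1 + s.2)
  have hweight : ∀ c : ℕ, (c : ℝ≥0∞) / (s.1 + s.2) = ENNReal.ofReal (c / (s.1 + s.2)) := fun c => by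
    rw [ENNReal.ofReal_div_of_pos hpos, ENNReal.ofReal_add (by positivity) (by positivity)]
    simp only [ENNReal.ofReal_natCast]
  rw [stepKernel_of_not_absorbed hs, lintegral_add_measure, lintegral_smul_measure,
    lintegral_smul_measure, lintegral_dirac, lintegral_dirac, hweight, hweight, smul_eq_mul,
    smul_eq_mul, ← ENNReal.ofReal_mul (by positivity), ← ENNReal.ofReal_mul (by positivity),
    ← ENNReal.ofReal_add (by positivity) (by positivity)]
  congr 1
  ring

lemma ofReal_stateValue_first_step {N : ℕ} {s : State} (hs : s ∈ reachable N) :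
    ENNReal.ofReal (stateValue s) = {s | Absorbed s}ᶜ.indicator 1 s +
      ∫⁻ y, ENNReal.ofReal (stateValue y) ∂stepKernel s := by
  by_cases habs : Absorbed s
  · rw [stepKernel_of_absorbed habs, lintegral_dirac, Set.indicator_of_notMem (by simpa using habs),
      zero_add]
  have hwhite := stateValue_nonneg (policyA_white_mem_reachable hs habs)
  have hblack := stateValue_nonneg (policyA_black_mem_reachable hs habs)
  rw [lintegral_ofReal_stepKernel habs hwhite hblack, Set.indicator_of_mem (by simpa using habs),
    Pi.one_apply, ← ENNReal.ofReal_one, ← ENNReal.ofReal_add zero_le_one (by positivity),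
    ← stateValue_first_step hs habs]

lemma stateValue_of_absorbed {N : ℕ} {s : State} (hs : s ∈ reachable N) (habs : Absorbed s) :
    stateValue s = 0 := by
  have hwhite : s.1 = 0 := habs.elim id fun h => by have := hs.1; omega
  rw [stateValue, hwhite, levelValue_zero]

theorem TA_self (k : ℕ) : TA (k + 1) (k + 1) = ENNReal.ofReal (tieTime (k + 1)) := by
  have hstart : policyA (k + 1, k + 1) = (k, k + 1) := if_pos le_rfl
  have hmem : (k, k + 1) ∈ reachable (2 * k + 1) :=
    ⟨k.lt_succ_self, ⟨k, by simp only; omega⟩, by simp only; omega⟩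
  obtain ⟨C, hC⟩ := ((finite_reachable (2 * k + 1)).image stateValue).bddAbove
  have h := lintegral_entranceTime_eq_of_first_step (A := {s | Absorbed s}) .of_discrete
    .of_discrete (fun s hs => ae_stepKernel (fun _ => hs) (absurd hs) (absurd hs))
    (fun s => ae_stepKernel_mem_reachable) .of_discrete ENNReal.ofReal_ne_top
    (fun s => ofReal_stateValue_first_step)
    (fun s hs => by rw [stateValue_of_absorbed hs.1 hs.2, ENNReal.ofReal_zero])
    (fun s hs => ENNReal.ofReal_le_ofReal (hC (Set.mem_image_of_mem stateValue hs))) hmem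
  rw [stateValue_eq (by omega : k + (k + 1) = 2 * k + 1), ← hstart] at h
  exact h

/-! ### Iterated averages -/

lemma tendsto_zero_of_succ_le_one_sub_mul {e q : ℕ → ℝ} (he : ∀ n, 0 ≤ e n) (hq : ∀ n, 0 ≤ q n)
    (hdiv : ¬ Summable q) (hstep : ∀ n, e (n + 1) ≤ (1 - q n) * e n) :
    Tendsto e atTop (𝓝 0) := by
  have hexp : ∀ n, e n ≤ e 0 * Real.exp (-∑ i ∈ Finset.range n, q i) := fun n => by
    induction n with
    | zero => simp
    | succ n ih =>
      calc e (n + 1) ≤ (1 - q n) * e n := hstep n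
        _ ≤ Real.exp (-q n) * e n := by gcongr; exacts [he n, Real.one_sub_le_exp_neg _]
        _ ≤ Real.exp (-q n) * (e 0 * Real.exp (-∑ i ∈ Finset.range n, q i)) := by gcongr
        _ = e 0 * Real.exp (-∑ i ∈ Finset.range (n + 1), q i) := by
          rw [Finset.sum_range_succ, neg_add, Real.exp_add]
          ring
  have hsum := (not_summable_iff_tendsto_nat_atTop_of_nonneg hq).1 hdiv
  have hlim := (Real.tendsto_exp_neg_atTop_nhds_zero.comp hsum).const_mul (e 0)
  rw [mul_zero] at hlim
  exact squeeze_zero he hexp hlim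

theorem tendsto_zero_of_succ_eq_average {F : Type*} [SeminormedAddCommGroup F] [NormedSpace ℝ F]
    {E r : ℕ → F} {q : ℕ → ℝ} (hq : ∀ n, 0 ≤ q n) (hq_le : ∀ n, q n ≤ 1) (hdiv : ¬ Summable q)
    (hE : ∀ n, E (n + 1) = (1 - q n) • E n + q n • r n) (hr : Tendsto r atTop (𝓝 0)) :
    Tendsto E atTop (𝓝 0) := by
  rw [tendsto_zero_iff_norm_tendsto_zero, Metric.tendsto_atTop] at hr
  rw [tendsto_zero_iff_norm_tendsto_zero, Metric.tendsto_atTop']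
  intro ε hε
  obtain ⟨N, hN⟩ := hr (ε / 2) (by positivity)
  simp only [dist_zero_right, norm_norm] at hN ⊢
  have hexcess : Tendsto (fun n => max (‖E (n + N)‖ - ε / 2) 0) atTop (𝓝 0) := by
    refine tendsto_zero_of_succ_le_one_sub_mul (q := fun n => q (n + N)) (fun _ => le_max_right _ _)
      (fun _ => hq _) (by rwa [summable_nat_add_iff]) fun n => ?_
    have hsub : 0 ≤ 1 - q (n + N) := sub_nonneg.2 (hq_le _)
    refine max_le ?_ (mul_nonneg hsub (le_max_right _ _))
    have hnorm : ‖E (n + 1 + N)‖ ≤ (1 - q (n + N)) * ‖E (n + N)‖ + q (n + N) * (ε / 2) := by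
      rw [add_right_comm, hE]
      refine (norm_add_le _ _).trans ?_
      rw [norm_smul, norm_smul, Real.norm_of_nonneg hsub, Real.norm_of_nonneg (hq _)]
      gcongr
      exacts [hq _, (hN _ (Nat.le_add_left _ _)).le]
    have hmax := mul_le_mul_of_nonneg_left (le_max_left (‖E (n + N)‖ - ε / 2) 0) hsub
    linarith
  obtain ⟨K, hK⟩ := eventually_atTop.1 (hexcess.eventually_lt_const (half_pos hε))
  refine ⟨K + N, fun n hn => ?_⟩
  have h := (le_max_left _ _).trans_lt (hK (n - N) (by omega))
  rw [Nat.sub_add_cancel (by omega)] at h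
  linarith

/-! ### Asymptotics of the coefficients -/

lemma invReturn_pos (n : ℕ) : 0 < invReturn n :=
  div_pos (by positivity) (by exact_mod_cast n.centralBinom_pos)

lemma invReturn_succ (n : ℕ) : invReturn (n + 1) = invReturn n * (1 + 1 / (2 * n + 1)) := by
  have hC : (0 : ℝ) < n.centralBinom := by exact_mod_cast n.centralBinom_pos
  have hC' : (0 : ℝ) < (n + 1).centralBinom := by exact_mod_cast (n + 1).centralBinom_pos
  have h : ((n : ℝ) + 1) * (n + 1).centralBinom = 2 * (2 * n + 1) * n.centralBinom := by
    exact_mod_cast n.succ_mul_centralBinom_succ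
  rw [invReturn, invReturn, pow_succ]
  field_simp
  linear_combination -2 * h

lemma one_le_invReturn (n : ℕ) : 1 ≤ invReturn n := by
  induction n with
  | zero => simp [invReturn]
  | succ n ih =>
    rw [invReturn_succ]
    exact one_le_mul_of_one_le_of_one_le ih (le_add_of_nonneg_right (by positivity))

lemma invReturn_sq (n : ℕ) : invReturn n ^ 2 = (2 * n + 1) * W n := by
  have hpow : (2 : ℝ) ^ (4 * n) = (4 ^ n) ^ 2 := by
    rw [show (4 : ℝ) = 2 ^ 2 by norm_num, ← pow_mul, ← pow_mul]
    congr 1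
    ring
  rw [Real.Wallis.W_eq_factorial_ratio, hpow, invReturn, Nat.centralBinom_eq_two_mul_choose,
    two_mul n, Nat.cast_add_choose]
  field_simp

lemma invReturn_sq_le (n : ℕ) : invReturn n ^ 2 ≤ π * n + π / 2 := by
  have h := mul_le_mul_of_nonneg_left (Real.Wallis.W_le n) (show (0 : ℝ) ≤ 2 * n + 1 by positivity)
  rw [invReturn_sq]
  linarith

lemma pi_sub_le_two_mul_W (n : ℕ) : π - π / (2 * n + 1) ≤ 2 * W n := by
  calc π - π / (2 * n + 1)
      ≤ π - π / (2 * n + 2) := by gcongr; norm_num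
    _ = 2 * ((2 * n + 1) / (2 * n + 2) * (π / 2)) := by field_simp; ring
    _ ≤ 2 * W n := by gcongr; exact Real.Wallis.le_W n

lemma le_invReturn_sq (n : ℕ) : π * n ≤ invReturn n ^ 2 := by
  have h := mul_le_mul_of_nonneg_left (pi_sub_le_two_mul_W n)
    (show (0 : ℝ) ≤ 2 * n + 1 by positivity)
  rw [mul_sub, mul_div_cancel₀ _ (by positivity)] at h
  rw [invReturn_sq]
  linarith

lemma invReturn_le (n : ℕ) : invReturn n ≤ 2 * n + 1 := by
  induction n with
  | zero => simp [invReturn]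
  | succ n ih =>
    calc invReturn (n + 1) ≤ (2 * n + 1) * (1 + 1 / (2 * n + 1)) := by
          rw [invReturn_succ]; gcongr
      _ ≤ 2 * ((n + 1 : ℕ) : ℝ) + 1 := by
          rw [mul_add, mul_one_div_cancel (by positivity)]
          push_cast
          linarith

lemma not_summable_two_div_one_add_invReturn :
    ¬ Summable fun n => 2 / (1 + invReturn n) := by
  intro h
  refine Real.not_summable_one_div_natCast ((summable_nat_add_iff 1).1
    (h.of_nonneg_of_le (fun n => by positivity) fun n => ?_))
  have := invReturn_pos n
  rw [div_le_div_iff₀ (by positivity) (by positivity)]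
  push_cast
  linarith [invReturn_le n]

lemma sqrt_pi_mul_le_invReturn (n : ℕ) : √(π * n) ≤ invReturn n :=
  Real.sqrt_le_iff.2 ⟨(invReturn_pos n).le, le_invReturn_sq n⟩

lemma invReturn_sub_sqrt_le (n : ℕ) :
    invReturn n - √(π * n) ≤ π / 2 / invReturn n := by
  have hs := Real.sqrt_nonneg (π * n)
  have hs_le := sqrt_pi_mul_le_invReturn n
  have hsq := Real.sq_sqrt (show 0 ≤ π * n by positivity)
  rw [le_div_iff₀ (invReturn_pos n)]
  nlinarith [invReturn_sq_le n, mul_nonneg hs (sub_nonneg.2 hs_le)]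

lemma tendsto_invReturn_atTop : Tendsto invReturn atTop atTop :=
  tendsto_atTop_mono sqrt_pi_mul_le_invReturn (Real.tendsto_sqrt_atTop.comp
    (tendsto_natCast_atTop_atTop.const_mul_atTop Real.pi_pos))

lemma tendsto_W_div_invReturn : Tendsto (fun n => W n / invReturn n) atTop (𝓝 0) :=
  Real.Wallis.tendsto_W_nhds_pi_div_two.div_atTop tendsto_invReturn_atTop

lemma tendsto_one_div_two_mul_add_one :
    Tendsto (fun n : ℕ => 1 / (2 * (n : ℝ) + 1)) atTop (𝓝 0) :=
  tendsto_const_nhds.div_atTop (tendsto_atTop_add_const_right _ _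
    (tendsto_natCast_atTop_atTop.const_mul_atTop two_pos))

lemma oddHarmonic_nonneg (n : ℕ) : 0 ≤ oddHarmonic n :=
  Finset.sum_nonneg fun _ _ => by positivity

lemma oddHarmonic_eq (n : ℕ) : oddHarmonic n = (harmonic (2 * n) : ℝ) - (harmonic n : ℝ) / 2 := by
  induction n with
  | zero => simp [oddHarmonic]
  | succ n ih =>
    rw [oddHarmonic_succ, ih, mul_add_one, harmonic_succ, harmonic_succ, harmonic_succ]
    push_cast
    field_simp
    ring

lemma tendsto_two_mul_oddHarmonic_sub_log :
    Tendsto (fun n : ℕ => 2 * oddHarmonic n - Real.log n) atTop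
      (𝓝 (Real.log 4 + Real.eulerMascheroniConstant)) := by
  have hharmonic := Real.tendsto_harmonic_sub_log
  have hdouble : Tendsto (fun n : ℕ => 2 * n) atTop atTop :=
    tendsto_id.const_mul_atTop' two_pos
  have hlim := (((hharmonic.comp hdouble).const_mul 2).sub hharmonic).add_const (2 * Real.log 2)
  have hlog : Real.log 4 = 2 * Real.log 2 := by
    rw [show (4 : ℝ) = 2 ^ 2 by norm_num, Real.log_pow, Nat.cast_ofNat]
  rw [hlog]
  convert hlim.congr' ?_ using 2
  · ring
  · filter_upwards [eventually_ne_atTop 0] with n hn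
    simp only [Function.comp, oddHarmonic_eq]
    push_cast
    rw [Real.log_mul two_ne_zero (Nat.cast_ne_zero.2 hn)]
    ring

lemma tendsto_log_div_invReturn :
    Tendsto (fun n : ℕ => Real.log n / invReturn n) atTop (𝓝 0) := by
  have hlog : Tendsto (fun n => 2 * (Real.log (invReturn n) / invReturn n)) atTop (𝓝 0) := by
    simpa using ((Real.isLittleO_log_id_atTop.tendsto_div_nhds_zero).comp
      tendsto_invReturn_atTop).const_mul 2
  refine squeeze_zero' (Eventually.of_forall fun n =>
    div_nonneg (Real.log_natCast_nonneg n) (invReturn_pos n).le) ?_ hlog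
  filter_upwards [eventually_gt_atTop 0] with n hn
  have hn' : (0 : ℝ) < n := by exact_mod_cast hn
  have hle : (n : ℝ) ≤ invReturn n ^ 2 :=
    (le_mul_of_one_le_left hn'.le (by linarith [Real.pi_gt_three])).trans (le_invReturn_sq n)
  rw [← mul_div_assoc]
  gcongr
  · exact (invReturn_pos n).le
  · simpa [Real.log_pow] using Real.log_le_log hn' hle

lemma tendsto_oddHarmonic_div_invReturn :
    Tendsto (fun n => oddHarmonic n / invReturn n) atTop (𝓝 0) := by
  have h := ((tendsto_two_mul_oddHarmonic_sub_log.div_atTop tendsto_invReturn_atTop).add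
    tendsto_log_div_invReturn).div_const 2
  rw [add_zero, zero_div] at h
  exact h.congr fun n => by ring

lemma tendsto_oddHarmonic_mul_two_mul_W_sub_pi :
    Tendsto (fun n => oddHarmonic n * (2 * W n - π)) atTop (𝓝 0) := by
  have hO : Tendsto (fun n : ℕ => -π *
      (oddHarmonic n / invReturn n * (W n / invReturn n))) atTop (𝓝 0) := by
    simpa using (tendsto_oddHarmonic_div_invReturn.mul tendsto_W_div_invReturn).const_mul (-π)
  refine tendsto_of_tendsto_of_tendsto_of_le_of_le hO tendsto_const_nhds (fun n => ?_) fun n =>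
    mul_nonpos_of_nonneg_of_nonpos (oddHarmonic_nonneg n) (by linarith [Real.Wallis.W_le n])
  have := Real.Wallis.W_pos n
  calc -π * (oddHarmonic n / invReturn n * (W n / invReturn n))
      = oddHarmonic n * -(π / (2 * n + 1)) := by
        rw [div_mul_div_comm, ← sq, invReturn_sq]
        field_simp
    _ ≤ oddHarmonic n * (2 * W n - π) :=
        mul_le_mul_of_nonneg_left (by linarith [pi_sub_le_two_mul_W n]) (oddHarmonic_nonneg n)

lemma two_div_le_log_add_one_sub_log {x : ℝ} (hx : 0 < x) :
    2 / (2 * x + 1) ≤ Real.log (x + 1) - Real.log x := by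
  calc 2 / (2 * x + 1) = 2 * (1 / x) / (1 / x + 2) := by field_simp; ring
    _ ≤ Real.log (1 + 1 / x) := Real.le_log_one_add_of_nonneg (by positivity)
    _ = Real.log (x + 1) - Real.log x := by
      rw [← Real.log_div (by positivity) hx.ne', add_div, div_self hx.ne']

lemma log_add_one_sub_log_le {x : ℝ} (hx : 0 < x) : Real.log (x + 1) - Real.log x ≤
    2 / (2 * x + 1) + 1 / (8 * x ^ 2) - 1 / (8 * (x + 1) ^ 2) := by
  have hone : 1 ≤ (x + 1) / x := by rw [le_div_iff₀ hx]; linarith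
  calc Real.log (x + 1) - Real.log x = Real.log ((x + 1) / x) :=
        (Real.log_div (by positivity) hx.ne').symm
    _ ≤ Real.sinh (Real.log ((x + 1) / x)) := Real.self_le_sinh_iff.2 (Real.log_nonneg hone)
    _ = ((x + 1) / x - ((x + 1) / x)⁻¹) / 2 := Real.sinh_log (by positivity)
    _ = 2 / (2 * x + 1) + 1 / (8 * x ^ 2) - 1 / (8 * (x + 1) ^ 2) -
        1 / (8 * (2 * x + 1) * x ^ 2 * (x + 1) ^ 2) := by field_simp; ring
    _ ≤ _ := sub_le_self _ (by positivity)

/-- The error in the approximation `2 * oddHarmonic n ≈ log n + log 4 + γ`. -/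
noncomputable def logError (n : ℕ) : ℝ :=
  2 * oddHarmonic n - (Real.log n + Real.log 4 + Real.eulerMascheroniConstant)

lemma logError_succ (n : ℕ) : logError (n + 1) =
    logError n + (2 / (2 * n + 1) - (Real.log (n + 1) - Real.log n)) := by
  rw [logError, logError, oddHarmonic_succ]
  push_cast
  ring

lemma tendsto_logError : Tendsto logError atTop (𝓝 0) := by
  have h := tendsto_two_mul_oddHarmonic_sub_log.sub_const
    (Real.log 4 + Real.eulerMascheroniConstant)
  rw [sub_self] at h
  exact h.congr fun n => by rw [logError]; ring

lemma logError_succ_nonneg (n : ℕ) : 0 ≤ logError (n + 1) := by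
  have hanti : Antitone fun n => logError (n + 1) := antitone_nat_of_succ_le fun n => by
    rw [logError_succ]
    linarith [two_div_le_log_add_one_sub_log (x := ((n + 1 : ℕ) : ℝ)) (by positivity)]
  exact hanti.le_of_tendsto ((tendsto_add_atTop_iff_nat 1).2 tendsto_logError) n

lemma logError_succ_le (n : ℕ) : logError (n + 1) ≤ 1 / (8 * ((n + 1 : ℕ) : ℝ) ^ 2) := by
  have hmono : Monotone fun n : ℕ => logError (n + 1) - 1 / (8 * ((n + 1 : ℕ) : ℝ) ^ 2) :=
    monotone_nat_of_le_succ fun n => by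
      have h := log_add_one_sub_log_le (x := ((n + 1 : ℕ) : ℝ)) (by positivity)
      rw [logError_succ (n + 1), Nat.cast_add_one (n + 1)]
      linarith
  have hzero : Tendsto (fun n : ℕ => 1 / (8 * (n : ℝ) ^ 2)) atTop (𝓝 0) :=
    tendsto_const_nhds.div_atTop (((tendsto_pow_atTop two_ne_zero).comp
      tendsto_natCast_atTop_atTop).const_mul_atTop (by norm_num))
  have hlim := (tendsto_add_atTop_iff_nat 1).2 (tendsto_logError.sub hzero)
  rw [sub_zero] at hlim
  exact sub_nonpos.1 (hmono.ge_of_tendsto hlim n)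

/-! ### Asymptotics of the absorption time -/

/-- The expansion in the theorem with `s` in place of `√(π k)` and `L` in place of
`log k + log 4 + γ`. -/
noncomputable def expansion (k s L : ℝ) : ℝ :=
  (k / 2 + π / 16 - s / 4) * L + 3 * π / 16 - s / 4 - 1 / 4

/-- The expansion with `√(π k)` and `log k + log 4 + γ` replaced by the quantities that occur in
the recursion for `tieTime`. -/
noncomputable def approximant (k : ℕ) : ℝ := expansion k (invReturn k) (2 * oddHarmonic k)

/-- The amount by which `approximant` fails the recursion for `tieTime`, relative to the weight
`2 / (1 + invReturn k)`. -/
noncomputable def defect (k : ℕ) : ℝ := (k + 1 / 2) * oddHarmonic k - approximant k -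
  (approximant (k + 1) - approximant k) * (1 + invReturn k) / 2

lemma defect_eq (k : ℕ) : defect k =
    oddHarmonic k * (2 * W k - π) / 8 +
      oddHarmonic k / invReturn k * W k / 4 +
      3 / 16 * (2 * W k - π) + 3 / 8 * (W k / invReturn k) -
      (1 / (2 * k + 1) + W k / invReturn k) * (1 / 4 + π / 16) +
      W k / invReturn k * (1 / (2 * k + 1) + W k / invReturn k) / 4 := by
  have hW : W k = invReturn k ^ 2 / (2 * k + 1) := by
    rw [invReturn_sq, mul_div_cancel_left₀ _ (by positivity)]
  rw [hW, defect, approximant, approximant, expansion, expansion, invReturn_succ, oddHarmonic_succ]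
  push_cast
  field_simp
  ring

lemma tendsto_defect : Tendsto defect atTop (𝓝 0) := by
  have hx := tendsto_one_div_two_mul_add_one
  have hW := Real.Wallis.tendsto_W_nhds_pi_div_two
  have hWa := tendsto_W_div_invReturn
  have hd : Tendsto (fun k => 2 * W k - π) atTop (𝓝 0) := by
    simpa [mul_div_cancel₀] using (hW.const_mul 2).sub_const π
  have hlim := (((((tendsto_oddHarmonic_mul_two_mul_W_sub_pi.div_const 8).add
    ((tendsto_oddHarmonic_div_invReturn.mul hW).div_const 4)).add (hd.const_mul (3 / 16))).add
    (hWa.const_mul (3 / 8))).sub ((hx.add hWa).mul_const (1 / 4 + π / 16))).add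
    ((hWa.mul (hx.add hWa)).div_const 4)
  simp only [zero_mul, mul_zero, zero_div, add_zero, sub_zero] at hlim
  exact hlim.congr fun k => (defect_eq k).symm

theorem tendsto_tieTime_sub_approximant :
    Tendsto (fun k => tieTime k - approximant k) atTop (𝓝 0) := by
  refine tendsto_zero_of_succ_eq_average (q := fun k => 2 / (1 + invReturn k)) (fun k => ?_)
    (fun k => ?_) not_summable_two_div_one_add_invReturn (fun k => ?_) tendsto_defect
  · have := invReturn_pos k
    positivity
  · have := one_le_invReturn k
    rw [div_le_one (by linarith)]
    linarith
  · have := invReturn_pos k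
    rw [tieTime_succ, defect, smul_eq_mul, smul_eq_mul]
    field_simp
    ring

lemma approximant_sub_expansion (k : ℕ) : approximant k - expansion k √(π * k)
      (Real.log k + Real.log 4 + Real.eulerMascheroniConstant) =
    (k / 2 + π / 16 - √(π * k) / 4) * logError k -
      (invReturn k - √(π * k)) * (oddHarmonic k / 2 + 1 / 4) := by
  rw [approximant, expansion, expansion, logError]
  ring

lemma tendsto_leadingCoeff_mul_logError : Tendsto (fun k : ℕ =>
    (k / 2 + π / 16 - √(π * k) / 4) * logError k) atTop (𝓝 0) := by
  have hcoeff_nonneg : ∀ x : ℝ, 0 ≤ x → 0 ≤ x / 2 + π / 16 - √(π * x) / 4 :=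
    fun x hx => by
      have hsqrt : √(π * x) ≤ x + π / 4 :=
        Real.sqrt_le_iff.2 ⟨by positivity, by linarith [sq_nonneg (x - π / 4)]⟩
      linarith
  have hcoeff_le : ∀ x : ℝ, 1 ≤ x → x / 2 + π / 16 - √(π * x) / 4 ≤ x :=
    fun x hx => by linarith [Real.pi_le_four, Real.sqrt_nonneg (π * x)]
  rw [← tendsto_add_atTop_iff_nat 1]
  refine squeeze_zero (fun k => mul_nonneg (hcoeff_nonneg _ (by positivity))
    (logError_succ_nonneg k)) (fun k => ?_) tendsto_one_div_add_atTop_nhds_zero_nat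
  calc _ ≤ ((k + 1 : ℕ) : ℝ) * (1 / (8 * ((k + 1 : ℕ) : ℝ) ^ 2)) :=
        mul_le_mul (hcoeff_le _ (by simp)) (logError_succ_le k) (logError_succ_nonneg k)
          (by positivity)
    _ = 1 / (k + 1) / 8 := by push_cast; field_simp
    _ ≤ 1 / ((k : ℝ) + 1) := div_le_self (by positivity) (by norm_num)

lemma tendsto_invReturn_sub_sqrt_mul : Tendsto (fun k : ℕ =>
    (invReturn k - √(π * k)) * (oddHarmonic k / 2 + 1 / 4)) atTop (𝓝 0) := by
  have hnonneg : ∀ k, 0 ≤ oddHarmonic k / 2 + 1 / 4 := fun k => by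
    linarith [oddHarmonic_nonneg k]
  have hlim := (tendsto_oddHarmonic_div_invReturn.const_mul (π / 4)).add
    (tendsto_invReturn_atTop.const_div_atTop (π / 8))
  rw [mul_zero, add_zero] at hlim
  refine squeeze_zero (fun k => mul_nonneg (sub_nonneg.2 (sqrt_pi_mul_le_invReturn k)) (hnonneg k))
    (fun k => ?_) hlim
  calc _ ≤ π / 2 / invReturn k * (oddHarmonic k / 2 + 1 / 4) :=
        mul_le_mul_of_nonneg_right (invReturn_sub_sqrt_le k) (hnonneg k)
    _ = π / 4 * (oddHarmonic k / invReturn k) + π / 8 / invReturn k := by ring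

theorem tendsto_tieTime_sub_expansion : Tendsto (fun k : ℕ => tieTime k -
    expansion k √(π * k) (Real.log k + Real.log 4 + Real.eulerMascheroniConstant))
    atTop (𝓝 0) := by
  have hlim := tendsto_tieTime_sub_approximant.add
    (tendsto_leadingCoeff_mul_logError.sub tendsto_invReturn_sub_sqrt_mul)
  rw [sub_zero, add_zero] at hlim
  refine hlim.congr fun k => ?_
  rw [← approximant_sub_expansion]
  ring

end Mabinogion

theorem theorem1 :
    (∀ k : ℕ, 1 ≤ k → Mabinogion.TA k k ≠ ∞) ∧
    Tendsto (fun k : ℕ =>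
      (Mabinogion.TA k k).toReal -
        (((k : ℝ) / 2 + Real.pi / 16 - Real.sqrt (Real.pi * k) / 4) *
            (Real.log k + Real.log 4 + Real.eulerMascheroniConstant) +
          3 * Real.pi / 16 - Real.sqrt (Real.pi * k) / 4 - 1 / 4))
      atTop (𝓝 0) := by
  have hTA : ∀ k : ℕ, 1 ≤ k →
      Mabinogion.TA k k = ENNReal.ofReal (Mabinogion.tieTime k) := fun k hk => by
    rw [← Nat.sub_add_cancel hk, Mabinogion.TA_self]
  refine ⟨fun k hk => hTA k hk ▸ ENNReal.ofReal_ne_top, ?_⟩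
  refine Mabinogion.tendsto_tieTime_sub_expansion.congr' ?_
  filter_upwards [eventually_ge_atTop 1] with k hk
  rw [hTA k hk, ENNReal.toReal_ofReal (Mabinogion.tieTime_nonneg k), Mabinogion.expansion]
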